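/- All graphs are finite and simple. For a graph $G$ with $n$ vertices and adjacency eigenvalues $\lambda_1,\dots,\lambda_n$, let $S_k(G)=\sum_{i=1}^n\lambda_i^k$. For graphs $G,H$ with $n$ vertices write $G\prec_s H$ if for some $k\in\{1,\dots,n-1\}$ one has $S_i(G)=S_i(H)$ for $0\le i\le k-1$ and $S_k(G)<S_k(H)$. Let $\mathscr T_n^{p,q}$ be the set of all $n$-vertex trees whose vertex set has a bipartition into independent sets of sizes $p$ and $q$. We say that $T_1,\dots,T_m$ are the last $m$ trees, in the $S$-order, among $\mathscr T_n^{p,q}$ if they belong to $\mathscr T_n^{p,q}$, $T_1\prec_s T_2\prec_s\cdots\prec_s T_m$, and every $T\in\mathscr T_n^{p,q}$ that is isomorphic to none of $T_1,\dots,T_m$ satisfies $T\prec_s T_j$ for all $j$. Let $B_{p,q}^{k,l}$ (with $k+l+1\le p$, $l+2\le q$) be the tree with $p$ white and $q$ black vertices, edges joining vertices of different colours only, in which a white vertex $u$ is adjacent to all $q$ black vertices, and the other $p-1$ white vertices are leaves: $k$ of them are attached to one black vertex $x$, $l$ of them are attached one each to $l$ further black vertices, and the remaining $p-1-k-l$ are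 attached to one further black vertex $v$. Let $D_{p,q}^{k,l}$ be the tree with $p$ white and $q$ black vertices defined in the same way with the two colours (and $p$, $q$) exchanged, that is, $D_{p,q}^{k,l}\cong B_{q,p}^{k,l}$. **Theorem.** Let $p,q,n$ be positive integers with $4\le p<q$ and $p+q=n$. (i) If $p>\frac{q+4}{2}$, the last four trees, in the $S$-order, among $\mathscr T_n^{p,q}$ are $B_{p,q}^{2,0},\,D_{p,q}^{0,1},\,B_{p,q}^{0,1},\,B_{p,q}^{0,0}$. (ii) If $p=\frac{q+4}{2}$, the last four trees, in the $S$-order, among $\mathscr T_n^{p,q}$ are $D_{p,q}^{0,1},\,B_{p,q}^{2,0},\,B_{p,q}^{0,1},\,B_{p,q}^{0,0}$. (iii) If $p<\frac{q+4}{2}$ and $p\ge 5$, the last four trees, in the $S$-order, among $\mathscr T_n^{p,q}$ are $B_{p,q}^{0,2},\,B_{p,q}^{2,0},\,B_{p,q}^{0,1},\,B_{p,q}^{0,0}$. If $p=4$ (in which case $p<\frac{q+4}{2}$ always holds), then $B_{p,q}^{2,0}\cong B_{p,q}^{0,1}$, and the last three trees, in the $S$-order, among $\mathscr T_n^{p,q}$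 are $B_{p,q}^{0,2},\,B_{p,q}^{0,1},\,B_{p,q}^{0,0}$. -/

import Mathlib

universe u v

open Classical in
/-- The `k`-th spectral moment of a finite graph: the sum of the `k`-th powers of the eigenvalues
(with multiplicity) of its real adjacency matrix. -/
noncomputable def spectralMoment {V : Type u} [Fintype V] (G : SimpleGraph V) (k : ℕ) : ℝ :=
  ∑ i, (G.isHermitian_adjMatrix ℝ).eigenvalues i ^ k

/-- `G` comes strictly before `H` in the `S`-order: for some `1 ≤ k ≤ n - 1`, where `n` is the
number of vertices, the moments of index `0, …, k - 1` agree and the `k`-th moment of `G` is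
smaller. (Agreement of the moments of index `0` says that `G` and `H` have equally many
vertices.) -/
def SBefore {V : Type u} {W : Type v} [Fintype V] [Fintype W]
    (G : SimpleGraph V) (H : SimpleGraph W) : Prop :=
  ∃ k : ℕ, 1 ≤ k ∧ k < Fintype.card V ∧
    (∀ i < k, spectralMoment G i = spectralMoment H i) ∧ spectralMoment G k < spectralMoment H k

/-- `G` is an `n`-vertex tree with a `(p, q)`-bipartition. -/
structure IsBipartitionedTree {V : Type u} [Fintype V] (n p q : ℕ) (G : SimpleGraph V) : Prop where
  isTree : G.IsTree
  card_eq : Fintype.card V = n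
  exists_parts : ∃ s t : Finset V, G.IsBipartiteWith s t ∧ (s : Set V) ∪ t = Set.univ ∧
    s.card = p ∧ t.card = q

/-- The trees in the list `L`, read from left to right, are the last `L.length` trees in the
`S`-order among all `n`-vertex trees with a `(p, q)`-bipartition, up to isomorphism: they are such
trees, each comes strictly before the later ones, and every such tree which is isomorphic to
none of them comes strictly before each of them. -/
structure AreLastTrees {W : Type v} [Fintype W] (n p q : ℕ) (L : List (SimpleGraph W)) : Prop where
  mem : ∀ G ∈ L, IsBipartitionedTree n p q G
  increasing : L.Pairwise fun G H => SBefore G H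
  last : ∀ (V : Type u) [Fintype V] (T : SimpleGraph V), IsBipartitionedTree n p q T →
    (∀ G ∈ L, IsEmpty (T ≃g G)) → ∀ G ∈ L, SBefore T G

/-- The bipartite graph on the disjoint union of `α` (white vertices) and `β` (black vertices)
in which a white vertex `i` and a black vertex `j` are adjacent iff `r i j`. -/
def bipartiteGraphOf {α : Type u} {β : Type v} (r : α → β → Prop) : SimpleGraph (α ⊕ β) where
  Adj a b :=
    match a, b with
    | Sum.inl i, Sum.inr j => r i j
    | Sum.inr j, Sum.inl i => r i j
    | _, _ => False
  symm := ⟨fun a b h => by cases a <;> cases b <;> exact h⟩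
  loopless := ⟨fun a h => by cases a <;> exact h⟩

/-- The index of the support vertex of the `i`-th leaf (`i = 1, 2, …`): the first `k` leaves hang
at vertex `1`, the next `l` leaves hang one each at the vertices `2, …, l + 1`, and all
remaining leaves hang at vertex `0`. -/
def supportIndex (k l i : ℕ) : ℕ :=
  if i ≤ k then 1 else if i ≤ k + l then i - k + 1 else 0

/-- The tree `B_{p,q}^{k,l}` (for `k + l + 1 ≤ p` and `l + 2 ≤ q`), with `p` white and `q` black
vertices. White vertex `0` is `u`, black vertex `0` is `v`. The vertex `u` is adjacent to all
black vertices. Of the `p - 1` other white vertices, which are leaves, `k` are attached to one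
and the same black vertex other than `v`, `l` are attached one each to `l` further black
vertices, and `p - 1 - k - l` are attached to `v`. -/
def treeB (p q k l : ℕ) : SimpleGraph (Fin p ⊕ Fin q) :=
  bipartiteGraphOf fun i j => i.val = 0 ∨ j.val = supportIndex k l i.val

/-- The tree `D_{p,q}^{k,l}` (for `k + l + 1 ≤ q` and `l + 2 ≤ p`): as `B`, with the colours
exchanged. The black vertex `0`, which is `v`, is adjacent to all `p` white vertices. Of the
`q - 1` other black vertices, which are leaves, `k` are attached to one and the same white vertex
other than `u` (the white vertex `0`), `l` are attached one each to `l` further white vertices,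
and `q - 1 - k - l` are attached to `u`. -/
def treeD (p q k l : ℕ) : SimpleGraph (Fin p ⊕ Fin q) :=
  bipartiteGraphOf fun i j => j.val = 0 ∨ i.val = supportIndex k l j.val

/-!
Trees are bipartite, so their odd moments vanish, and `S₀` and `S₂` depend only on the number of
vertices. The comparison therefore starts with `S₄ = 2 ∑ (deg v - 1)² + 4n - 6`, where the excesses
`deg v - 1` add up to `q - 1` over the white and to `p - 1` over the black vertices. By convexity
`S₄` is small unless some vertex, a hub, is adjacent to the whole opposite class. All other vertices
in the class of a hub are leaves, so the tree is determined by a partition of `p - 1` (white hub) or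
`q - 1` (black hub) into the numbers of leaves at the neighbours of the hub. The moments `S₄` and
`S₆` of such a tree are explicit in the power sums of this partition; only the partitions with
largest part at least `p - 3`, or at least `q - 2` for a black hub, can compete, and whenever `S₄`
does not decide between two trees, `S₆` does.
-/

/-! ### Spectral moments -/

section SpectralMoment

variable {V : Type u} {W : Type v} [Fintype V] [Fintype W] {G : SimpleGraph V} {H : SimpleGraph W}

theorem spectralMoment_eq_trace [DecidableEq V] [DecidableRel G.Adj] (k : ℕ) :
    spectralMoment G k = (G.adjMatrix ℝ ^ k).trace := by
  have diagonalize := (G.isHermitian_adjMatrix ℝ).spectral_theorem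
  have moment_eq : spectralMoment G k = ∑ i, (G.isHermitian_adjMatrix ℝ).eigenvalues i ^ k := by
    unfold spectralMoment
    congr!
  rw [moment_eq]
  conv_rhs =>
    rw [diagonalize, ← map_pow, Unitary.conjStarAlgAut_apply, Matrix.trace_mul_cycle,
      Unitary.coe_star_mul_self, one_mul, Matrix.diagonal_pow, Matrix.trace_diagonal]
  simp

theorem spectralMoment_congr (e : G ≃g H) (k : ℕ) : spectralMoment G k = spectralMoment H k := by
  classical
  have reindex_pow :
      H.adjMatrix ℝ ^ k = Matrix.reindexAlgEquiv ℝ ℝ e.toEquiv (G.adjMatrix ℝ ^ k) := by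
    rw [map_pow, ← e.reindex_adjMatrix ℝ]
    rfl
  rw [spectralMoment_eq_trace, spectralMoment_eq_trace, reindex_pow]
  exact (e.toEquiv.symm.sum_comp fun v => (G.adjMatrix ℝ ^ k) v v).symm

@[simp]
theorem spectralMoment_zero (G : SimpleGraph V) : spectralMoment G 0 = Fintype.card V := by
  simp [spectralMoment]

theorem spectralMoment_two [DecidableRel G.Adj] :
    spectralMoment G 2 = 2 * G.edgeFinset.card := by
  classical
  have sum_degrees : ∑ v, (G.degree v : ℝ) = 2 * G.edgeFinset.card := by
    exact_mod_cast G.sum_degrees_eq_twice_card_edges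
  simp only [spectralMoment_eq_trace, ← sum_degrees, Matrix.trace, Matrix.diag_apply, pow_two,
    SimpleGraph.adjMatrix_mul_self_apply_self]

theorem spectralMoment_of_odd (hG : G.IsBipartite) {k : ℕ} (hk : Odd k) :
    spectralMoment G k = 0 := by
  classical
  rw [spectralMoment_eq_trace]
  refine Finset.sum_eq_zero fun v _ => ?_
  rw [Matrix.diag_apply, SimpleGraph.adjMatrix_pow_apply_eq_card_walk, Nat.cast_eq_zero,
    Fintype.card_eq_zero_iff]
  exact ⟨fun w => Nat.not_even_iff_odd.2 hk <|
    w.2 ▸ SimpleGraph.two_colorable_iff_forall_loop_even.1 hG v w.1⟩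

theorem adjMatrix_sq_apply [DecidableEq V] [DecidableRel G.Adj] (v w : V) :
    (G.adjMatrix ℝ ^ 2) v w = Fintype.card (G.commonNeighbors v w) := by
  simp [pow_two, Finset.filter_filter, SimpleGraph.neighborFinset_eq_filter,
    SimpleGraph.mem_commonNeighbors, Fintype.card_subtype, and_comm]

theorem sum_adjMatrix_sq [DecidableEq V] [DecidableRel G.Adj] :
    ∑ v, ∑ w, (G.adjMatrix ℝ ^ 2) v w = ∑ v, (G.degree v : ℝ) ^ 2 := by
  calc ∑ v, ∑ w, (G.adjMatrix ℝ ^ 2) v w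
      = ∑ u, (∑ v, G.adjMatrix ℝ v u) * ∑ w, G.adjMatrix ℝ u w := by
        simp only [pow_two, Matrix.mul_apply, Finset.sum_mul_sum]
        rw [Finset.sum_congr rfl fun v _ => Finset.sum_comm, Finset.sum_comm]
    _ = ∑ u, (G.degree u : ℝ) ^ 2 := by
        simp [pow_two, SimpleGraph.adjMatrix_apply, SimpleGraph.adj_comm,
          ← SimpleGraph.neighborFinset_eq_filter]

/-- The hypothesis says that `G` contains no cycle of length four. -/
theorem spectralMoment_four [DecidableRel G.Adj]
    (h : ∀ v w, v ≠ w → (G.commonNeighbors v w).Subsingleton) :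
    spectralMoment G 4 = 2 * ∑ v, (G.degree v : ℝ) ^ 2 - ∑ v, (G.degree v : ℝ) := by
  classical
  have sq_mul_sq (v w : V) : (G.adjMatrix ℝ ^ 2) v w * (G.adjMatrix ℝ ^ 2) w v =
      (G.adjMatrix ℝ ^ 2) v w + if v = w then (G.degree v : ℝ) ^ 2 - G.degree v else 0 := by
    split_ifs with hvw
    · rw [← hvw, pow_two (G.adjMatrix ℝ), SimpleGraph.adjMatrix_mul_self_apply_self]
      ring
    · have : Fintype.card (G.commonNeighbors v w) ≤ 1 :=
        Fintype.card_le_one_iff_subsingleton.2 (h v w hvw).coe_sort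
      simp only [adjMatrix_sq_apply, G.commonNeighbors_symm w v]
      interval_cases Fintype.card (G.commonNeighbors v w) <;> simp
  have trace_eq : spectralMoment G 4 =
      ∑ v, ∑ w, (G.adjMatrix ℝ ^ 2) v w * (G.adjMatrix ℝ ^ 2) w v := by
    rw [spectralMoment_eq_trace, pow_add _ 2 2]
    simp only [Matrix.trace, Matrix.diag_apply, Matrix.mul_apply]
  simp only [trace_eq, sq_mul_sq, Finset.sum_add_distrib, sum_adjMatrix_sq, Finset.sum_ite_eq,
    Finset.mem_univ, if_true, Finset.sum_sub_distrib]
  ring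

end SpectralMoment

/-- The sum of the `k`-th powers of the elements of `s`. -/
def powerSum (s : Multiset ℕ) (k : ℕ) : ℕ :=
  (s.map (· ^ k)).sum

@[simp]
theorem powerSum_cons (a : ℕ) (s : Multiset ℕ) (k : ℕ) :
    powerSum (a ::ₘ s) k = a ^ k + powerSum s k := by
  rw [powerSum, Multiset.map_cons, Multiset.sum_cons, powerSum]

@[simp]
theorem powerSum_singleton (a k : ℕ) : powerSum {a} k = a ^ k := by
  rw [powerSum, Multiset.map_singleton, Multiset.sum_singleton]

theorem powerSum_add (s t : Multiset ℕ) (k : ℕ) :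
    powerSum (s + t) k = powerSum s k + powerSum t k := by
  rw [powerSum, Multiset.map_add, Multiset.sum_add, powerSum, powerSum]

theorem powerSum_one (s : Multiset ℕ) : powerSum s 1 = s.sum := by
  simp only [powerSum, pow_one, Multiset.map_id']

section Tree

variable {V : Type u} {W : Type v} [Fintype V] [Fintype W] {G : SimpleGraph V} {H : SimpleGraph W}

theorem commonNeighbors_subsingleton {V : Type*} {G : SimpleGraph V} (hG : G.IsAcyclic) {v w : V}
    (hvw : v ≠ w) : (G.commonNeighbors v w).Subsingleton := by
  rintro x ⟨hvx, hwx⟩ y ⟨hvy, hwy⟩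
  have isPath {z : V} (hvz : G.Adj v z) (hwz : G.Adj w z) :
      (SimpleGraph.Walk.cons hvz hwz.symm.toWalk).IsPath := by
    simp [hvw, hvz.ne, hwz.ne']
  have unique := (hG.subsingleton_path v w).elim ⟨_, isPath hvx hwx⟩ ⟨_, isPath hvy hwy⟩
  exact congrArg (fun P : G.Path v w => P.1.getVert 1) unique

open Classical in
/-- The multiset of the excesses `deg v - 1` of the vertices `v ∈ s`, which governs the fourth
moment of a tree. In a tree with at least two vertices no subtraction is truncated. -/
noncomputable def excessDegrees (G : SimpleGraph V) (s : Finset V) : Multiset ℕ :=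
  s.val.map fun v => G.degree v - 1

theorem spectralMoment_two_of_isTree (hG : G.IsTree) :
    spectralMoment G 2 = 2 * (Fintype.card V - 1) := by
  classical
  rw [spectralMoment_two, ← hG.card_edgeFinset]
  push_cast
  ring

theorem spectralMoment_four_of_isTree [Nontrivial V] (hG : G.IsTree) :
    spectralMoment G 4 =
      2 * (powerSum (excessDegrees G Finset.univ) 2 : ℝ) + 4 * Fintype.card V - 6 := by
  classical
  have degree_eq (v : V) : (G.degree v : ℝ) = (G.degree v - 1 : ℕ) + 1 := by
    rw [Nat.cast_pred (hG.connected.preconnected.degree_pos_of_nontrivial v), sub_add_cancel]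
  have sum_degrees : ∑ v, (G.degree v : ℝ) = 2 * (Fintype.card V - 1) := by
    rw [← spectralMoment_two_of_isTree hG, spectralMoment_two]
    exact_mod_cast G.sum_degrees_eq_twice_card_edges
  have sum_excess : powerSum (excessDegrees G Finset.univ) 2 =
      ∑ v, (G.degree v - 1) ^ 2 := by
    simp only [powerSum, excessDegrees, Multiset.map_map, Finset.sum, Function.comp_def]
  rw [spectralMoment_four fun v w => commonNeighbors_subsingleton hG.isAcyclic, sum_excess]
  simp only [degree_eq, add_sq, Finset.sum_add_distrib, ← Finset.mul_sum, ← Finset.sum_mul,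
    Finset.sum_const, Finset.card_univ, nsmul_eq_mul] at sum_degrees ⊢
  push_cast at sum_degrees ⊢
  linarith

theorem spectralMoment_eq_of_lt_four (hG : G.IsTree) (hH : H.IsTree)
    (hcard : Fintype.card V = Fintype.card W) {k : ℕ} (hk : k < 4) :
    spectralMoment G k = spectralMoment H k := by
  interval_cases k
  · rw [spectralMoment_zero, spectralMoment_zero, hcard]
  · rw [spectralMoment_of_odd hG.isBipartite odd_one, spectralMoment_of_odd hH.isBipartite odd_one]
  · rw [spectralMoment_two_of_isTree hG, spectralMoment_two_of_isTree hH, hcard]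
  · rw [spectralMoment_of_odd hG.isBipartite (by decide),
      spectralMoment_of_odd hH.isBipartite (by decide)]

namespace SBefore

theorem of_four_lt (hG : G.IsTree) (hH : H.IsTree) (hcard : Fintype.card V = Fintype.card W)
    (hV : 4 < Fintype.card V) (h : spectralMoment G 4 < spectralMoment H 4) : SBefore G H :=
  ⟨4, by norm_num, hV, fun _ => spectralMoment_eq_of_lt_four hG hH hcard, h⟩

theorem of_six_lt (hG : G.IsTree) (hH : H.IsTree) (hcard : Fintype.card V = Fintype.card W)
    (hV : 6 < Fintype.card V) (h₄ : spectralMoment G 4 = spectralMoment H 4)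
    (h₆ : spectralMoment G 6 < spectralMoment H 6) : SBefore G H := by
  refine ⟨6, by norm_num, hV, fun k hk => ?_, h₆⟩
  rcases lt_or_ge k 4 with hk' | hk'
  · exact spectralMoment_eq_of_lt_four hG hH hcard hk'
  · interval_cases k
    · exact h₄
    · rw [spectralMoment_of_odd hG.isBipartite (by decide),
        spectralMoment_of_odd hH.isBipartite (by decide)]

theorem congr_left (e : G ≃g H) {U : Type*} [Fintype U] {K : SimpleGraph U} (h : SBefore H K) :
    SBefore G K := by
  obtain ⟨k, one_le, lt_card, agree, lt⟩ := h
  exact ⟨k, one_le, Fintype.card_congr e.toEquiv ▸ lt_card,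
    fun i hi => (spectralMoment_congr e i).trans (agree i hi), spectralMoment_congr e k ▸ lt⟩

theorem card_eq (h : SBefore G H) : Fintype.card V = Fintype.card W := by
  obtain ⟨k, one_le, -, agree, -⟩ := h
  simpa using agree 0 one_le

protected theorem trans {U : Type*} [Fintype U] {K : SimpleGraph U} (hGH : SBefore G H)
    (hHK : SBefore H K) : SBefore G K := by
  have card_eq := hGH.card_eq
  obtain ⟨k, k_pos, k_lt, agree, lt⟩ := hGH
  obtain ⟨l, l_pos, l_lt, agree', lt'⟩ := hHK
  rcases lt_trichotomy k l with hkl | rfl | hlk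
  · exact ⟨k, k_pos, k_lt, fun i hi => (agree i hi).trans (agree' i (hi.trans hkl)),
      lt.trans_eq (agree' k hkl)⟩
  · exact ⟨k, k_pos, k_lt, fun i hi => (agree i hi).trans (agree' i hi), lt.trans lt'⟩
  · exact ⟨l, l_pos, card_eq ▸ l_lt, fun i hi => (agree i (hi.trans hlk)).trans (agree' i hi),
      (agree l hlk).trans_lt lt'⟩

instance : IsTrans (SimpleGraph V) SBefore := ⟨fun _ _ _ => SBefore.trans⟩

end SBefore

end Tree

/-! ### Bipartite trees and hubs -/

section Bipartition

variable {V : Type u} [Fintype V] {G : SimpleGraph V} {s t : Finset V}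

theorem union_eq_univ_of_isBipartiteWith [Nontrivial V] [DecidableEq V] (hG : G.Connected)
    (hst : G.IsBipartiteWith s t) : s ∪ t = Finset.univ := by
  refine Finset.eq_univ_of_forall fun v => ?_
  obtain ⟨w, hvw⟩ := hG.preconnected.exists_adj_of_nontrivial v
  rw [Finset.mem_union]
  exact (hst.mem_of_adj hvw).imp And.left And.left

theorem excessDegrees_univ [Nontrivial V] (hG : G.Connected) (hst : G.IsBipartiteWith s t) :
    excessDegrees G Finset.univ = excessDegrees G s + excessDegrees G t := by
  classical
  have hdisj : Disjoint s t := Finset.disjoint_coe.1 hst.disjoint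
  rw [excessDegrees, ← union_eq_univ_of_isBipartiteWith hG hst,
    ← Finset.disjUnion_eq_union s t hdisj, Finset.disjUnion_val, Multiset.map_add]
  rfl

theorem sum_excessDegrees_add_one [Nontrivial V] (hG : G.IsTree) (hst : G.IsBipartiteWith s t) :
    (excessDegrees G s).sum + 1 = t.card := by
  classical
  have one_le_degree (v : V) : 1 ≤ G.degree v :=
    hG.connected.preconnected.degree_pos_of_nontrivial v
  have card_parts : s.card + t.card = Fintype.card V := by
    rw [← Finset.card_union_of_disjoint (Finset.disjoint_coe.1 hst.disjoint),
      union_eq_univ_of_isBipartiteWith hG.connected hst, Finset.card_univ]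
  have sum_excess : (excessDegrees G s).sum + s.card = G.edgeFinset.card := by
    rw [← SimpleGraph.isBipartiteWith_sum_degrees_eq_card_edges hst, Finset.card_eq_sum_ones]
    change ∑ v ∈ s, (G.degree v - 1) + _ = _
    rw [← Finset.sum_add_distrib]
    exact Finset.sum_congr rfl fun v _ => Nat.sub_add_cancel (one_le_degree v)
  have := hG.card_edgeFinset
  omega

/-- The vertex `u` of one class is adjacent to every vertex of the opposite class `t`. -/
def IsHub (G : SimpleGraph V) (t : Finset V) (u : V) : Prop :=
  ∀ w ∈ t, G.Adj u w

theorem excessDegrees_le_of_not_isHub (hst : G.IsBipartiteWith s t)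
    (hs : ∀ u ∈ s, ¬ IsHub G t u) : ∀ x ∈ excessDegrees G s, x ≤ t.card - 2 := by
  classical
  intro x hx
  obtain ⟨v, hv, rfl⟩ := Multiset.mem_map.1 hx
  obtain ⟨w, hw, hvw⟩ : ∃ w ∈ t, ¬ G.Adj v w := by simpa [IsHub] using hs v hv
  have neighbors_ssubset : G.neighborFinset v ⊂ t :=
    (Finset.ssubset_iff_of_subset
      (SimpleGraph.isBipartiteWith_neighborFinset_subset hst hv)).2 ⟨w, hw, by simpa using hvw⟩
  have := Finset.card_lt_card neighbors_ssubset
  rw [SimpleGraph.card_neighborFinset_eq_degree] at this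
  omega

end Bipartition

section BipartiteGraphOf

variable {α β : Type*}

section Adjacency

variable (r : α → β → Prop)

@[simp]
theorem bipartiteGraphOf_adj_inl_inr (i : α) (j : β) :
    (bipartiteGraphOf r).Adj (Sum.inl i) (Sum.inr j) ↔ r i j := Iff.rfl

@[simp]
theorem bipartiteGraphOf_adj_inr_inl (i : α) (j : β) :
    (bipartiteGraphOf r).Adj (Sum.inr j) (Sum.inl i) ↔ r i j := Iff.rfl

@[simp]
theorem not_bipartiteGraphOf_adj_inl_inl (i i' : α) :
    ¬ (bipartiteGraphOf r).Adj (Sum.inl i) (Sum.inl i') := id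

@[simp]
theorem not_bipartiteGraphOf_adj_inr_inr (j j' : β) :
    ¬ (bipartiteGraphOf r).Adj (Sum.inr j) (Sum.inr j') := id

end Adjacency

open Classical in
/-- The biadjacency matrix of the relation `r`: the off-diagonal block of the adjacency matrix of
`bipartiteGraphOf r`. -/
noncomputable def biadjMatrix (r : α → β → Prop) : Matrix α β ℝ :=
  Matrix.of fun i j => if r i j then 1 else 0

theorem adjMatrix_bipartiteGraphOf (r : α → β → Prop) [DecidableRel (bipartiteGraphOf r).Adj] :
    (bipartiteGraphOf r).adjMatrix ℝ =
      Matrix.fromBlocks 0 (biadjMatrix r) (biadjMatrix r).transpose 0 := by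
  ext (i | i) (j | j) <;> rw [SimpleGraph.adjMatrix_apply] <;>
    split_ifs with h <;> simp_all [biadjMatrix]

theorem trace_mul_pow_succ_comm [Fintype α] [Fintype β] [DecidableEq α] [DecidableEq β]
    {R : Type*} [CommSemiring R] (M : Matrix α β R) (N : Matrix β α R) (k : ℕ) :
    ((M * N) ^ (k + 1)).trace = ((N * M) ^ (k + 1)).trace := by
  have slide (k : ℕ) : (M * N) ^ k * M = M * (N * M) ^ k := by
    induction k with
    | zero => simp
    | succ k ih => rw [pow_succ', Matrix.mul_assoc, ih, pow_succ']; simp only [Matrix.mul_assoc]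
  rw [pow_succ, ← Matrix.mul_assoc, slide, Matrix.trace_mul_comm, ← Matrix.mul_assoc, ← pow_succ']

theorem spectralMoment_bipartiteGraphOf [Fintype α] [Fintype β] [DecidableEq β]
    (r : α → β → Prop) (k : ℕ) :
    spectralMoment (bipartiteGraphOf r) (2 * (k + 1)) =
      2 * (((biadjMatrix r).transpose * biadjMatrix r) ^ (k + 1)).trace := by
  classical
  rw [spectralMoment_eq_trace, adjMatrix_bipartiteGraphOf, pow_mul, pow_two,
    Matrix.fromBlocks_multiply]
  simp only [add_zero, zero_add, Matrix.zero_mul, Matrix.mul_zero,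
    Matrix.fromBlocks_diagonal_pow, Matrix.trace, Fintype.sum_sum_type, Matrix.diag_apply,
    Matrix.fromBlocks_apply₁₁, Matrix.fromBlocks_apply₂₂]
  rw [two_mul]
  exact congrArg (· + _) (trace_mul_pow_succ_comm (biadjMatrix r) (biadjMatrix r).transpose k)

theorem isBipartiteWith_bipartiteGraphOf [Fintype α] [Fintype β] (r : α → β → Prop) :
    (bipartiteGraphOf r).IsBipartiteWith ((Finset.univ.map .inl : Finset (α ⊕ β)) : Set (α ⊕ β))
      (Finset.univ.map .inr : Finset (α ⊕ β)) where
  disjoint := by simp [Set.disjoint_left]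
  mem_of_adj := by rintro (i | i) (j | j) h <;> simp_all

end BipartiteGraphOf

section HubTree

variable {β : Type v}

/-- The bipartite tree with black vertices `β` in which one white vertex, the hub `none`, is
adjacent to all black vertices, and every other white vertex is a leaf: `f j` leaves hang at the
black vertex `j`. -/
def hubTree (f : β → ℕ) : SimpleGraph (Option (Σ j, Fin (f j)) ⊕ β) :=
  bipartiteGraphOf fun o j => ∀ x ∈ o, x.1 = j

variable [Fintype β] (f : β → ℕ)

theorem card_hubTree : Fintype.card (Option (Σ j, Fin (f j)) ⊕ β) =
    Fintype.card β + ∑ j, f j + 1 := by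
  simp
  omega

theorem transpose_biadjMatrix_mul_self_hubTree [DecidableEq β] :
    (biadjMatrix fun (o : Option (Σ j, Fin (f j))) j => ∀ x ∈ o, x.1 = j).transpose *
      biadjMatrix (fun (o : Option (Σ j, Fin (f j))) j => ∀ x ∈ o, x.1 = j) =
      Matrix.of 1 + Matrix.diagonal fun j => (f j : ℝ) := by
  ext i j
  rcases eq_or_ne i j with rfl | hij
  · simp [Matrix.mul_apply, biadjMatrix, Fintype.sum_option, Fintype.sum_sigma]
  · simp [Matrix.mul_apply, biadjMatrix, Fintype.sum_option, Fintype.sum_sigma, hij, hij.symm]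

theorem trace_ones_add_diagonal_sq [DecidableEq β] (d : β → ℝ) :
    ((Matrix.of 1 + Matrix.diagonal d) ^ 2).trace =
      Fintype.card β ^ 2 + 2 * ∑ j, d j + ∑ j, d j ^ 2 := by
  simp only [Matrix.trace, Matrix.diag_apply, pow_two, add_mul, mul_add, Matrix.add_apply,
    Matrix.mul_apply, Matrix.of_apply, Pi.one_apply, Matrix.diagonal_apply, Finset.sum_add_distrib]
  simp
  ring

theorem trace_ones_add_diagonal_cube [DecidableEq β] (d : β → ℝ) :
    ((Matrix.of 1 + Matrix.diagonal d) ^ 3).trace =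
      Fintype.card β ^ 3 + 3 * Fintype.card β * ∑ j, d j + 3 * ∑ j, d j ^ 2 + ∑ j, d j ^ 3 := by
  simp only [Matrix.trace, Matrix.diag_apply, pow_succ, pow_zero, one_mul, add_mul, mul_add,
    Matrix.add_apply, Matrix.mul_apply, Matrix.of_apply, Pi.one_apply, Matrix.diagonal_apply,
    Finset.sum_add_distrib]
  simp [← Finset.mul_sum]
  ring

theorem spectralMoment_two_hubTree :
    spectralMoment (hubTree f) 2 = 2 * (Fintype.card β + ∑ j, (f j : ℝ)) := by
  classical
  rw [hubTree, spectralMoment_bipartiteGraphOf _ 0, transpose_biadjMatrix_mul_self_hubTree]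
  simp [Matrix.trace, Finset.sum_add_distrib]

theorem spectralMoment_four_hubTree : spectralMoment (hubTree f) 4 =
    2 * (Fintype.card β ^ 2 + 2 * ∑ j, (f j : ℝ) + ∑ j, (f j : ℝ) ^ 2) := by
  classical
  rw [hubTree, spectralMoment_bipartiteGraphOf _ 1, transpose_biadjMatrix_mul_self_hubTree,
    trace_ones_add_diagonal_sq]

theorem spectralMoment_six_hubTree : spectralMoment (hubTree f) 6 =
    2 * (Fintype.card β ^ 3 + 3 * Fintype.card β * ∑ j, (f j : ℝ) + 3 * ∑ j, (f j : ℝ) ^ 2 +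
      ∑ j, (f j : ℝ) ^ 3) := by
  classical
  rw [hubTree, spectralMoment_bipartiteGraphOf _ 2, transpose_biadjMatrix_mul_self_hubTree,
    trace_ones_add_diagonal_cube]

theorem connected_hubTree {β : Type*} (f : β → ℕ) : (hubTree f).Connected := by
  have inr_reachable (j : β) : (hubTree f).Reachable (Sum.inl none) (Sum.inr j) :=
    SimpleGraph.Adj.reachable (by simp [hubTree])
  refine (SimpleGraph.connected_iff_exists_forall_reachable _).2 ⟨Sum.inl none, ?_⟩
  rintro ((_ | ⟨j, x⟩) | j)
  · rfl
  · exact (inr_reachable j).trans (SimpleGraph.Adj.reachable (by simp [hubTree]))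
  · exact inr_reachable j

theorem isTree_hubTree {β : Type*} [Finite β] (f : β → ℕ) : (hubTree f).IsTree := by
  classical
  have := Fintype.ofFinite β
  have card_edges : 2 * ((hubTree f).edgeFinset.card : ℝ) =
      2 * ((Fintype.card β + ∑ j, f j : ℕ) : ℝ) := by
    rw [← spectralMoment_two, spectralMoment_two_hubTree]
    push_cast
    rfl
  refine SimpleGraph.isTree_iff_connected_and_card.2 ⟨connected_hubTree f, ?_⟩
  rw [Nat.card_eq_fintype_card, Nat.card_eq_fintype_card, card_hubTree,
    ← SimpleGraph.edgeFinset_card]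
  exact congrArg (· + 1) (by exact_mod_cast mul_left_cancel₀ two_ne_zero card_edges)

end HubTree

section Isomorphism

/-- Equivalences between the colour classes that respect the defining relations induce an
isomorphism of bipartite graphs. -/
def bipartiteGraphOfIso {α β α' β' : Type*} {r : α → β → Prop} {r' : α' → β' → Prop}
    (e : α ≃ α') (σ : β ≃ β') (h : ∀ i j, r' (e i) (σ j) ↔ r i j) :
    bipartiteGraphOf r ≃g bipartiteGraphOf r' where
  toEquiv := e.sumCongr σ
  map_rel_iff' {a b} := by rcases a with i | i <;> rcases b with j | j <;> simp [h]

theorem not_adj_of_isBipartiteWith {V : Type*} {G : SimpleGraph V} {s t : Set V}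
    (hst : G.IsBipartiteWith s t) {v w : V} (hv : v ∈ s) (hw : w ∈ s) : ¬ G.Adj v w :=
  fun hvw => hst.disjoint.notMem_of_mem_left hw (hst.mem_of_mem_adj hv hvw)

/-- A bipartite graph is isomorphic to the graph given by adjacency between its colour classes. -/
noncomputable def isoBipartiteGraphOf {V : Type*} [DecidableEq V] {G : SimpleGraph V}
    {s t : Finset V} [Fintype V] (hst : G.IsBipartiteWith s t) (hcover : s ∪ t = Finset.univ) :
    bipartiteGraphOf (fun (v : s) (w : t) => G.Adj v w) ≃g G where
  toEquiv := (Equiv.Finset.union s t (Finset.disjoint_coe.1 hst.disjoint)).trans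
    (Equiv.subtypeUnivEquiv fun v => hcover ▸ Finset.mem_univ v)
  map_rel_iff' {a b} := by
    rcases a with i | i <;> rcases b with j | j
    · simpa using not_adj_of_isBipartiteWith hst i.2 j.2
    · simp
    · simp [SimpleGraph.adj_comm]
    · simpa using not_adj_of_isBipartiteWith hst.symm i.2 j.2

theorem exists_equiv_of_map_univ_eq {α β γ : Type*} [Fintype α] [Fintype β] {f : α → γ} {g : β → γ}
    (h : Finset.univ.val.map f = Finset.univ.val.map g) : ∃ σ : α ≃ β, ∀ a, g (σ a) = f a := by
  classical
  have fiber_equiv (c : γ) : Nonempty ({a // f a = c} ≃ {b // g b = c}) := by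
    refine Fintype.card_eq.1 ?_
    simp only [Fintype.card_subtype, eq_comm (b := c)]
    simpa only [Multiset.count_map, ← Finset.filter_val, Finset.card_val] using
      congrArg (Multiset.count c) h
  exact ⟨Equiv.ofFiberEquiv fun c => (fiber_equiv c).some, Equiv.ofFiberEquiv_map _⟩

theorem hubTree_congr {β γ : Type*} {f : β → ℕ} {g : γ → ℕ} (σ : β ≃ γ)
    (h : ∀ j, g (σ j) = f j) : Nonempty (hubTree f ≃g hubTree g) := by
  refine ⟨bipartiteGraphOfIso
    (Equiv.optionCongr (Equiv.sigmaCongr σ fun j => finCongr (h j).symm)) σ ?_⟩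
  rintro (_ | ⟨i, x⟩) j <;> simp [Equiv.sigmaCongr]

end Isomorphism

/-- The multiset of the nonzero values of `f`, with multiplicity. -/
def nonzeroValues {β : Type*} [Fintype β] (f : β → ℕ) : Multiset ℕ :=
  (Finset.univ.val.map f).filter (· ≠ 0)

section NonzeroValues

variable {β : Type*} [Fintype β]

theorem map_univ_eq_nonzeroValues_add (f : β → ℕ) : Finset.univ.val.map f =
    nonzeroValues f + Multiset.replicate (Fintype.card β - (nonzeroValues f).card) 0 := by
  have split : Finset.univ.val.map f =
      nonzeroValues f + Multiset.replicate ((Finset.univ.val.map f).count 0) 0 := by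
    rw [← Multiset.filter_eq', nonzeroValues, add_comm, Multiset.filter_add_not]
  have card_eq := congrArg Multiset.card split
  rw [Multiset.card_map, Finset.card_val, Finset.card_univ, Multiset.card_add,
    Multiset.card_replicate] at card_eq
  rwa [card_eq, Nat.add_sub_cancel_left]

theorem powerSum_nonzeroValues (f : β → ℕ) {k : ℕ} (hk : k ≠ 0) :
    powerSum (nonzeroValues f) k = ∑ j, f j ^ k := by
  have powerSum_zeros (m : ℕ) : powerSum (Multiset.replicate m 0) k = 0 := by
    rw [powerSum, Multiset.map_replicate, zero_pow hk, Multiset.sum_replicate, smul_zero]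
  calc powerSum (nonzeroValues f) k = powerSum (Finset.univ.val.map f) k := by
        rw [map_univ_eq_nonzeroValues_add f, powerSum_add, powerSum_zeros, add_zero]
    _ = ∑ j, f j ^ k := by rw [powerSum, Multiset.map_map, Finset.sum, Function.comp_def]

theorem sum_nonzeroValues (f : β → ℕ) : (nonzeroValues f).sum = ∑ j, f j := by
  simpa only [powerSum_one, pow_one] using powerSum_nonzeroValues f one_ne_zero

end NonzeroValues

/-- `T` is a tree in which one vertex, the hub, is adjacent to all `q` vertices of the opposite
class, so that every other vertex of the class of the hub is a leaf. The nonzero numbers of leaves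
at the `q` neighbours of the hub form the multiset `s`. -/
def IsHubTree {V : Type*} (q : ℕ) (s : Multiset ℕ) (T : SimpleGraph V) : Prop :=
  ∃ f : Fin q → ℕ, nonzeroValues f = s ∧ Nonempty (T ≃g hubTree f)

theorem IsHubTree.of_iso_hubTree {V β : Type*} [Fintype β] {T : SimpleGraph V} {f : β → ℕ}
    (e : T ≃g hubTree f) :
    IsHubTree (Fintype.card β) (nonzeroValues f) T := by
  let σ := Fintype.equivFin β
  obtain ⟨e'⟩ := hubTree_congr (f := f) (g := f ∘ σ.symm) σ (by simp)
  refine ⟨f ∘ σ.symm, ?_, ⟨e.trans e'⟩⟩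
  rw [nonzeroValues, ← Multiset.map_map, Multiset.map_univ_val_equiv, nonzeroValues]

theorem IsHubTree.congr {V W : Type*} {q : ℕ} {s : Multiset ℕ} {T : SimpleGraph V}
    {T' : SimpleGraph W} (h : IsHubTree q s T') (e : T ≃g T') : IsHubTree q s T := by
  obtain ⟨f, hf, ⟨e'⟩⟩ := h
  exact ⟨f, hf, ⟨e.trans e'⟩⟩

theorem isHubTree_bipartiteGraphOf {α β : Type*} [Fintype α] [Fintype β] [DecidableEq α]
    {r : α → β → Prop} [DecidableRel r] {u : α} (hub : ∀ j, r u j)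
    (leaf : ∀ i ≠ u, ∃! j, r i j) :
    IsHubTree (Fintype.card β)
      (nonzeroValues fun j => Fintype.card {i // i ≠ u ∧ r i j})
      (bipartiteGraphOf r) := by
  classical
  choose support support_adj support_unique using fun i : {i // i ≠ u} => leaf i i.2
  have support_eq_iff (i : {i // i ≠ u}) (j : β) : support i = j ↔ r i j :=
    ⟨fun h => h ▸ support_adj i, fun h => (support_unique i j h).symm⟩
  have card_fiber (j : β) :
      Fintype.card {i // support i = j} = Fintype.card {i // i ≠ u ∧ r i j} := by
    simp only [support_eq_iff]
    exact Fintype.card_congr (Equiv.subtypeSubtypeEquivSubtypeInter _ fun i => r i j)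
  let leafEquiv := (Equiv.sigmaCongrRight fun j =>
    (Fintype.equivFinOfCardEq (card_fiber j)).symm).trans (Equiv.sigmaFiberEquiv support)
  have support_leafEquiv (x) : support (leafEquiv x) = x.1 :=
    ((Fintype.equivFinOfCardEq (card_fiber x.1)).symm x.2).2
  let e := leafEquiv.optionCongr.trans (Equiv.optionSubtypeNe u)
  refine IsHubTree.of_iso_hubTree (bipartiteGraphOfIso e (Equiv.refl β) ?_).symm
  rintro (_ | ⟨j', x⟩) j
  · simp [e, hub]
  · simp [e, ← support_eq_iff, support_leafEquiv]

theorem isHubTree_of_isHub {V : Type*} [Fintype V] [Nontrivial V] {T : SimpleGraph V}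
    (hT : T.IsTree) {s t : Finset V} (hst : T.IsBipartiteWith s t) {u : V} (hu : u ∈ s)
    (hub : IsHub T t u) : IsHubTree t.card ((excessDegrees T t).filter (· ≠ 0)) T := by
  classical
  have leaf (v : s) (hv : v ≠ ⟨u, hu⟩) : ∃! w : t, T.Adj v w := by
    obtain ⟨w, hvw⟩ := hT.connected.preconnected.exists_adj_of_nontrivial v
    refine ⟨⟨w, hst.mem_of_mem_adj v.2 hvw⟩, hvw, fun w' hvw' => Subtype.ext ?_⟩
    have hvu : (v : V) ≠ u := fun h => hv (Subtype.ext h)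
    exact commonNeighbors_subsingleton hT.isAcyclic hvu ⟨hvw', hub _ w'.2⟩
      ⟨hvw, hub _ (hst.mem_of_mem_adj v.2 hvw)⟩
  have leaf_count (w : t) :
      Fintype.card {v : s // v ≠ ⟨u, hu⟩ ∧ T.Adj v w} = T.degree w - 1 := by
    have hwu : u ∈ T.neighborFinset w := by simpa using (hub w w.2).symm
    rw [← SimpleGraph.card_neighborFinset_eq_degree, ← Finset.card_erase_of_mem hwu,
      Fintype.card_subtype, ← Finset.card_map (.subtype (· ∈ s))]
    congr 1
    ext v
    simpa [SimpleGraph.adj_comm, Subtype.ext_iff] using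
      fun _ hvw => hst.symm.mem_of_mem_adj w.2 hvw.symm
  have key := isHubTree_bipartiteGraphOf (r := fun (v : s) (w : t) => T.Adj v w)
    (fun w => hub w w.2) leaf
  have excess_eq : nonzeroValues (fun w : t => T.degree w - 1) =
      (excessDegrees T t).filter (· ≠ 0) := by
    rw [nonzeroValues, excessDegrees]
    exact congrArg (Multiset.filter (· ≠ 0))
      (Multiset.attach_map_val' t.val fun w => T.degree w - 1)
  simp only [leaf_count, Fintype.card_coe, excess_eq] at key
  exact key.congr
    (isoBipartiteGraphOf hst (union_eq_univ_of_isBipartiteWith hT.connected hst)).symm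

namespace IsHubTree

variable {V : Type u} {W : Type v} {T : SimpleGraph V} {T' : SimpleGraph W} {q q' : ℕ}
  {s s' : Multiset ℕ}

theorem nonempty_iso (h : IsHubTree q s T) (h' : IsHubTree q s T') : Nonempty (T ≃g T') := by
  obtain ⟨f, hf, ⟨e⟩⟩ := h
  obtain ⟨f', hf', ⟨e'⟩⟩ := h'
  have map_eq : Finset.univ.val.map f = Finset.univ.val.map f' := by
    rw [map_univ_eq_nonzeroValues_add f, map_univ_eq_nonzeroValues_add f', hf, hf']
  obtain ⟨σ, hσ⟩ := exists_equiv_of_map_univ_eq map_eq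
  obtain ⟨e''⟩ := hubTree_congr σ hσ
  exact ⟨(e.trans e'').trans e'.symm⟩

variable [Fintype V] [Fintype W]

theorem isTree {V : Type*} {T : SimpleGraph V} (h : IsHubTree q s T) : T.IsTree := by
  obtain ⟨f, -, ⟨e⟩⟩ := h
  exact e.isTree_iff.2 (isTree_hubTree f)

theorem card_eq (h : IsHubTree q s T) : Fintype.card V = q + s.sum + 1 := by
  obtain ⟨f, rfl, ⟨e⟩⟩ := h
  rw [Fintype.card_congr e.toEquiv, card_hubTree, sum_nonzeroValues, Fintype.card_fin]

theorem spectralMoment_four (h : IsHubTree q s T) :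
    spectralMoment T 4 = 2 * (q ^ 2 + 2 * s.sum + powerSum s 2 : ℕ) := by
  obtain ⟨f, rfl, ⟨e⟩⟩ := h
  rw [spectralMoment_congr e, spectralMoment_four_hubTree, sum_nonzeroValues,
    powerSum_nonzeroValues f two_ne_zero, Fintype.card_fin]
  norm_cast

theorem spectralMoment_six (h : IsHubTree q s T) :
    spectralMoment T 6 =
      2 * (q ^ 3 + 3 * q * s.sum + 3 * powerSum s 2 + powerSum s 3 : ℕ) := by
  obtain ⟨f, rfl, ⟨e⟩⟩ := h
  rw [spectralMoment_congr e, spectralMoment_six_hubTree, sum_nonzeroValues,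
    powerSum_nonzeroValues f two_ne_zero, powerSum_nonzeroValues f three_ne_zero,
    Fintype.card_fin]
  norm_cast

theorem sBefore_of_four_lt (h : IsHubTree q s T) (h' : IsHubTree q' s' T')
    (hcard : q + s.sum = q' + s'.sum) (hV : 4 ≤ q + s.sum)
    (h₄ : q ^ 2 + 2 * s.sum + powerSum s 2 < q' ^ 2 + 2 * s'.sum + powerSum s' 2) :
    SBefore T T' := by
  refine .of_four_lt h.isTree h'.isTree (by rw [h.card_eq, h'.card_eq, hcard])
    (by rw [h.card_eq]; omega) ?_
  rw [h.spectralMoment_four, h'.spectralMoment_four]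
  exact_mod_cast Nat.mul_lt_mul_of_pos_left h₄ two_pos

theorem sBefore_of_six_lt (h : IsHubTree q s T) (h' : IsHubTree q' s' T')
    (hcard : q + s.sum = q' + s'.sum) (hV : 6 ≤ q + s.sum)
    (h₄ : q ^ 2 + 2 * s.sum + powerSum s 2 = q' ^ 2 + 2 * s'.sum + powerSum s' 2)
    (h₆ : q ^ 3 + 3 * q * s.sum + 3 * powerSum s 2 + powerSum s 3 <
      q' ^ 3 + 3 * q' * s'.sum + 3 * powerSum s' 2 + powerSum s' 3) :
    SBefore T T' := by
  refine .of_six_lt h.isTree h'.isTree (by rw [h.card_eq, h'.card_eq, hcard])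
    (by rw [h.card_eq]; omega) ?_ ?_
  · rw [h.spectralMoment_four, h'.spectralMoment_four, h₄]
  · rw [h.spectralMoment_six, h'.spectralMoment_six]
    exact_mod_cast Nat.mul_lt_mul_of_pos_left h₆ two_pos

end IsHubTree

/-! ### The trees `B` and `D` -/

section ConcreteTrees

variable {p q k l : ℕ}

theorem supportIndex_lt (k l i : ℕ) : supportIndex k l i < l + 2 := by
  unfold supportIndex
  split_ifs <;> omega

/-- The number of leaves at the black vertex `j` of `treeB p q k l`. -/
def treeBLeafCount (p k l j : ℕ) : ℕ :=
  if j = 0 then p - 1 - k - l else if j = 1 then k else if j < l + 2 then 1 else 0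

theorem card_filter_supportIndex (hp : k + l + 1 ≤ p) (j : ℕ) :
    (Finset.filter (fun i => supportIndex k l i = j) (Finset.Ioo 0 p)).card =
      treeBLeafCount p k l j := by
  have card_eq (s : Finset ℕ) (hs : ∀ i, i ∈ s ↔ (0 < i ∧ i < p) ∧ supportIndex k l i = j) :
      (Finset.filter (fun i => supportIndex k l i = j) (Finset.Ioo 0 p)).card = s.card :=
    congrArg Finset.card (Finset.ext fun i => by rw [Finset.mem_filter, Finset.mem_Ioo, hs])
  unfold supportIndex at card_eq ⊢
  unfold treeBLeafCount
  split_ifs with h₀ h₁ hl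
  · rw [card_eq (Finset.Ioo (k + l) p) (by grind), Nat.card_Ioo]
    omega
  · rw [card_eq (Finset.Ioc 0 k) (by grind), Nat.card_Ioc, Nat.sub_zero]
  · rw [card_eq {k + j - 1} (by grind), Finset.card_singleton]
  · rw [card_eq ∅ (by grind), Finset.card_empty]

theorem nonzeroValues_treeBLeafCount (p k : ℕ) (hq : l + 2 ≤ q) :
    nonzeroValues (fun j : Fin q => treeBLeafCount p k l j) =
      ((p - 1 - k - l) ::ₘ k ::ₘ Multiset.replicate l 1).filter (· ≠ 0) := by
  obtain ⟨m, rfl⟩ : ∃ m, q = 2 + l + m := ⟨q - (2 + l), by omega⟩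
  have map_eq : Finset.univ.val.map (fun j : Fin (2 + l + m) => treeBLeafCount p k l j) =
      (Multiset.range (2 + l + m)).map (treeBLeafCount p k l) := by
    rw [Finset.val_univ_fin, ← Multiset.coe_range, Multiset.map_coe, Multiset.map_coe,
      ← List.map_coe_finRange_eq_range, List.map_map]
    rfl
  have ones : (Multiset.range l).map (fun j => treeBLeafCount p k l (2 + j)) =
      Multiset.replicate l 1 := by
    rw [Multiset.map_congr rfl fun j hj => ?_, Multiset.map_const', Multiset.card_range]
    have := Multiset.mem_range.1 hj
    grind [treeBLeafCount]
  have zeros : (Multiset.range m).map (fun j => treeBLeafCount p k l (2 + l + j)) =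
      Multiset.replicate m 0 := by
    rw [Multiset.map_congr rfl fun j _ => ?_, Multiset.map_const', Multiset.card_range]
    grind [treeBLeafCount]
  have head : (Multiset.range 2).map (treeBLeafCount p k l) = {p - 1 - k - l, k} := rfl
  rw [nonzeroValues, map_eq, Multiset.range_add, Multiset.range_add, Multiset.map_add,
    Multiset.map_add, Multiset.map_map, Multiset.map_map, Function.comp_def, Function.comp_def,
    ones, zeros, head, Multiset.filter_add _ _ (Multiset.replicate m 0),
    Multiset.filter_eq_nil.2 fun j hj => not_not.2 (Multiset.eq_of_mem_replicate hj), add_zero]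
  rfl

theorem isHubTree_treeB (hp : k + l + 1 ≤ p) (hq : l + 2 ≤ q) :
    IsHubTree q (((p - 1 - k - l) ::ₘ k ::ₘ Multiset.replicate l 1).filter (· ≠ 0))
      (treeB p q k l) := by
  have : NeZero p := ⟨by omega⟩
  have leaf (i : Fin p) (hi : i ≠ 0) :
      ∃! j : Fin q, i.val = 0 ∨ j.val = supportIndex k l i.val :=
    ⟨⟨_, (supportIndex_lt k l i).trans_le hq⟩, .inr rfl,
      fun j hj => Fin.ext (hj.resolve_left (Fin.val_ne_zero_iff.2 hi))⟩
  have leaf_count (j : Fin q) :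
      Fintype.card {i : Fin p // i ≠ 0 ∧ (i.val = 0 ∨ j.val = supportIndex k l i.val)} =
        treeBLeafCount p k l j := by
    rw [← card_filter_supportIndex hp, Fintype.card_subtype, ← Finset.card_map Fin.valEmbedding]
    congr 1
    ext i
    simp only [Finset.mem_map, Finset.mem_filter, Finset.mem_univ, true_and, Finset.mem_Ioo,
      Fin.valEmbedding_apply, Fin.exists_iff, ← Fin.val_ne_zero_iff]
    grind
  have key := isHubTree_bipartiteGraphOf (u := (0 : Fin p))
    (r := fun i (j : Fin q) => i.val = 0 ∨ j.val = supportIndex k l i.val)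
    (fun _ => .inl rfl) leaf
  simp only [leaf_count, Fintype.card_fin, nonzeroValues_treeBLeafCount p k hq] at key
  exact key

/-- Exchanging the colours of a bipartite graph. -/
def bipartiteGraphOfSwap {α β : Type*} (r : α → β → Prop) :
    bipartiteGraphOf r ≃g bipartiteGraphOf fun j i => r i j where
  toEquiv := Equiv.sumComm α β
  map_rel_iff' {a b} := by rcases a with i | i <;> rcases b with j | j <;> simp

theorem isBipartitionedTree_bipartiteGraphOf {r : Fin p → Fin q → Prop}
    (h : (bipartiteGraphOf r).IsTree) : IsBipartitionedTree (p + q) p q (bipartiteGraphOf r) where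
  isTree := h
  card_eq := by simp
  exists_parts := ⟨_, _, isBipartiteWith_bipartiteGraphOf r, by ext (i | j) <;> simp, by simp,
    by simp⟩

theorem isHubTree_treeB_zero_zero (hp : 2 ≤ p) (hq : 2 ≤ q) :
    IsHubTree q {p - 1} (treeB p q 0 0) := by
  have nonzero : p - 1 ≠ 0 := by omega
  simpa [nonzero, Multiset.filter_singleton, Nat.sub_sub] using
    isHubTree_treeB (p := p) (q := q) (k := 0) (l := 0) (by omega) hq

theorem isHubTree_treeB_zero_one (hp : 3 ≤ p) (hq : 3 ≤ q) :
    IsHubTree q {p - 2, 1} (treeB p q 0 1) := by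
  have nonzero : p - 2 ≠ 0 := by omega
  simpa [nonzero, Multiset.filter_singleton, Nat.sub_sub] using
    isHubTree_treeB (p := p) (q := q) (k := 0) (l := 1) (by omega) hq

theorem isHubTree_treeB_two_zero (hp : 4 ≤ p) (hq : 2 ≤ q) :
    IsHubTree q {p - 3, 2} (treeB p q 2 0) := by
  have nonzero : p - 3 ≠ 0 := by omega
  simpa [nonzero, Multiset.filter_singleton, Nat.sub_sub] using
    isHubTree_treeB (p := p) (q := q) (k := 2) (l := 0) (by omega) hq

theorem isHubTree_treeB_zero_two (hp : 4 ≤ p) (hq : 4 ≤ q) :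
    IsHubTree q {p - 3, 1, 1} (treeB p q 0 2) := by
  have nonzero : p - 3 ≠ 0 := by omega
  simpa [nonzero, Multiset.filter_singleton, Multiset.replicate_succ, Nat.sub_sub] using
    isHubTree_treeB (p := p) (q := q) (k := 0) (l := 2) (by omega) hq

theorem isHubTree_treeD_zero_one (hp : 3 ≤ p) (hq : 3 ≤ q) :
    IsHubTree p {q - 2, 1} (treeD p q 0 1) :=
  (isHubTree_treeB_zero_one hq hp).congr (bipartiteGraphOfSwap _)

end ConcreteTrees

/-! ### Power sums of partitions -/

section PowerSum

variable {s : Multiset ℕ} {m k : ℕ}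

theorem powerSum_succ_le (hs : ∀ x ∈ s, x ≤ m) (k : ℕ) :
    powerSum s (k + 1) ≤ m * powerSum s k := by
  rw [powerSum, powerSum, ← Multiset.sum_map_mul_left]
  exact Multiset.sum_map_le_sum_map _ _ fun x hx =>
    (pow_succ' x k).trans_le (Nat.mul_le_mul_right _ (hs x hx))

theorem powerSum_two_le_sum_sq (s : Multiset ℕ) : powerSum s 2 ≤ s.sum ^ 2 := by
  have := powerSum_succ_le (s := s) (fun x hx => Multiset.le_sum_of_mem hx) 1
  rwa [powerSum_one, ← sq] at this

theorem powerSum_two_le_sq_add_sq (hs : ∀ x ∈ s, x ≤ m) (hsum : s.sum = m + k) :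
    powerSum s 2 ≤ m ^ 2 + k ^ 2 := by
  by_cases large : ∃ x ∈ s, k ≤ x
  · obtain ⟨x, hx, hkx⟩ := large
    obtain ⟨t, rfl⟩ := Multiset.exists_cons_of_mem hx
    obtain ⟨a, rfl⟩ := Nat.exists_eq_add_of_le hkx
    obtain ⟨b, rfl⟩ := Nat.exists_eq_add_of_le (hs _ hx)
    rw [Multiset.sum_cons] at hsum
    have ht := powerSum_two_le_sum_sq t
    rw [show t.sum = k + b by omega] at ht
    calc powerSum ((k + a) ::ₘ t) 2 = (k + a) ^ 2 + powerSum t 2 := powerSum_cons _ _ _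
      _ ≤ (k + a + b) ^ 2 + k ^ 2 := by nlinarith
  · push Not at large
    have bound_m := powerSum_succ_le hs 1
    have bound_k := powerSum_succ_le (fun x hx => (large x hx).le) 1
    rw [powerSum_one, hsum] at bound_m bound_k
    rcases le_total m k with hmk | hkm <;> nlinarith

theorem eq_of_sum_le_two (hs : 0 ∉ s) (hsum : s.sum ≤ 2) :
    s = 0 ∨ s = {1} ∨ s = {2} ∨ s = {1, 1} := by
  rcases s.empty_or_exists_mem with rfl | ⟨x, hx⟩
  · exact .inl rfl
  obtain ⟨t, rfl⟩ := Multiset.exists_cons_of_mem hx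
  rcases t.empty_or_exists_mem with rfl | ⟨y, hy⟩
  · rw [Multiset.cons_zero, Multiset.sum_singleton] at hsum
    interval_cases x <;> simp_all
  obtain ⟨r, rfl⟩ := Multiset.exists_cons_of_mem hy
  simp only [Multiset.mem_cons, not_or, Multiset.sum_cons] at hs hsum
  obtain ⟨rfl, rfl, hr⟩ : x = 1 ∧ y = 1 ∧ r.sum = 0 := by omega
  have r_eq : r = 0 := Multiset.eq_zero_of_forall_notMem fun z hz =>
    hs.2.2 (Multiset.sum_eq_zero_iff.1 hr z hz ▸ hz)
  exact .inr (.inr (.inr (by rw [r_eq]; rfl)))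

theorem partition_cases (hs : 0 ∉ s) (hsum : s.sum = m + 3) :
    s = {m + 3} ∨ s = {m + 2, 1} ∨ s = {m + 1, 2} ∨ s = {m + 1, 1, 1} ∨ ∀ x ∈ s, x ≤ m := by
  by_cases large : ∃ x ∈ s, m < x
  · obtain ⟨x, hx, hmx⟩ := large
    obtain ⟨t, rfl⟩ := Multiset.exists_cons_of_mem hx
    rw [Multiset.sum_cons] at hsum
    rw [Multiset.mem_cons, not_or] at hs
    rcases eq_of_sum_le_two hs.2 (by omega) with rfl | rfl | rfl | rfl
    · obtain rfl : x = m + 3 := by simpa using hsum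
      exact .inl rfl
    · obtain rfl : x = m + 2 := by simpa using hsum
      exact .inr (.inl rfl)
    · obtain rfl : x = m + 1 := by simpa using hsum
      exact .inr (.inr (.inl rfl))
    · obtain rfl : x = m + 1 := Nat.add_right_cancel (m := 2) hsum
      exact .inr (.inr (.inr (.inl rfl)))
  · push Not at large
    exact .inr (.inr (.inr (.inr large)))

end PowerSum

/-! ### The order of the last trees -/

section Order

variable {p q : ℕ}

theorem treeB_zero_one_sBefore_treeB_zero_zero (hp : 4 ≤ p) (hq : 3 ≤ q) :
    SBefore (treeB p q 0 1) (treeB p q 0 0) := by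
  obtain ⟨a, rfl⟩ := Nat.exists_eq_add_of_le' hp
  refine (isHubTree_treeB_zero_one (by omega) hq).sBefore_of_four_lt
    (isHubTree_treeB_zero_zero (by omega) (by omega)) rfl ?_ ?_ <;>
    simp <;> nlinarith

theorem treeB_two_zero_sBefore_treeB_zero_one (hp : 5 ≤ p) (hq : 3 ≤ q) :
    SBefore (treeB p q 2 0) (treeB p q 0 1) := by
  obtain ⟨a, rfl⟩ := Nat.exists_eq_add_of_le' hp
  refine (isHubTree_treeB_two_zero (by omega) (by omega)).sBefore_of_four_lt
    (isHubTree_treeB_zero_one (by omega) hq) rfl ?_ ?_ <;>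
    simp <;> nlinarith

theorem treeB_zero_two_sBefore_treeB_two_zero (hp : 4 ≤ p) (hq : 4 ≤ q) :
    SBefore (treeB p q 0 2) (treeB p q 2 0) := by
  obtain ⟨a, rfl⟩ := Nat.exists_eq_add_of_le' hp
  refine (isHubTree_treeB_zero_two hp hq).sBefore_of_four_lt
    (isHubTree_treeB_two_zero hp (by omega)) rfl ?_ ?_ <;>
    simp
  omega

theorem treeB_two_zero_iso_treeB_zero_one (hq : 3 ≤ q) :
    Nonempty (treeB 4 q 2 0 ≃g treeB 4 q 0 1) :=
  (isHubTree_treeB_two_zero le_rfl (by omega)).nonempty_iso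
    (Multiset.pair_comm 2 1 ▸ isHubTree_treeB_zero_one (p := 4) (by norm_num) hq)

theorem treeB_zero_two_sBefore_treeB_zero_one (hp : 4 ≤ p) (hq : 4 ≤ q) :
    SBefore (treeB p q 0 2) (treeB p q 0 1) := by
  obtain ⟨a, rfl⟩ := Nat.exists_eq_add_of_le' hp
  refine (isHubTree_treeB_zero_two hp hq).sBefore_of_four_lt
    (isHubTree_treeB_zero_one (by omega) (by omega)) rfl ?_ ?_ <;>
    simp <;> nlinarith

theorem treeD_zero_one_sBefore_treeB_zero_one (hp : 3 ≤ p) (hpq : p < q) :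
    SBefore (treeD p q 0 1) (treeB p q 0 1) := by
  obtain ⟨a, rfl⟩ := Nat.exists_eq_add_of_le' hp
  obtain ⟨b, rfl⟩ := Nat.exists_eq_add_of_lt hpq
  refine (isHubTree_treeD_zero_one hp (by omega)).sBefore_of_four_lt
    (isHubTree_treeB_zero_one hp (by omega)) ?_ ?_ ?_ <;>
    simp <;> nlinarith

theorem treeB_two_zero_sBefore_treeD_zero_one (hp : 4 ≤ p) (hpq : p < q) (h : q + 4 < 2 * p) :
    SBefore (treeB p q 2 0) (treeD p q 0 1) := by
  obtain ⟨a, rfl⟩ := Nat.exists_eq_add_of_le' hp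
  obtain ⟨b, rfl⟩ := Nat.exists_eq_add_of_lt hpq
  refine (isHubTree_treeB_two_zero hp (by omega)).sBefore_of_four_lt
    (isHubTree_treeD_zero_one (by omega) (by omega)) ?_ ?_ ?_ <;>
    simp <;> nlinarith

theorem treeD_zero_one_sBefore_treeB_two_zero (hp : 5 ≤ p) (hq : q + 4 = 2 * p) :
    SBefore (treeD p q 0 1) (treeB p q 2 0) := by
  obtain ⟨a, rfl⟩ := Nat.exists_eq_add_of_le' hp
  obtain rfl : q = 2 * a + 6 := by omega
  refine (isHubTree_treeD_zero_one (by omega) (by omega)).sBefore_of_six_lt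
    (isHubTree_treeB_two_zero (by omega) (by omega)) ?_ ?_ ?_ ?_ <;>
    simp <;> nlinarith

theorem treeD_zero_one_sBefore_treeB_zero_two (hp : 4 ≤ p) (hpq : p < q) (h : 2 * p < q + 4) :
    SBefore (treeD p q 0 1) (treeB p q 0 2) := by
  obtain ⟨a, rfl⟩ := Nat.exists_eq_add_of_le' hp
  have treeD_hub := isHubTree_treeD_zero_one (p := a + 4) (q := q) (by omega) (by omega)
  have treeB_hub := isHubTree_treeB_zero_two (p := a + 4) (q := q) (by omega) (by omega)
  -- The fourth moments agree exactly when `q = 2 * p - 3`.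
  rcases (show 2 * a + 5 ≤ q by omega).eq_or_lt with rfl | hq
  · refine treeD_hub.sBefore_of_six_lt treeB_hub ?_ ?_ ?_ ?_ <;>
      simp <;> nlinarith
  · obtain ⟨b, rfl⟩ := Nat.exists_eq_add_of_lt hq
    refine treeD_hub.sBefore_of_four_lt treeB_hub ?_ ?_ ?_ <;>
      simp <;> nlinarith

theorem treeB_zero_two_sBefore_treeD_zero_one (hp : 4 ≤ p) (hpq : p < q) (h : q + 4 ≤ 2 * p) :
    SBefore (treeB p q 0 2) (treeD p q 0 1) := by
  obtain ⟨a, rfl⟩ := Nat.exists_eq_add_of_le' hp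
  obtain ⟨b, rfl⟩ := Nat.exists_eq_add_of_lt hpq
  refine (isHubTree_treeB_zero_two (by omega) (by omega)).sBefore_of_four_lt
    (isHubTree_treeD_zero_one (by omega) (by omega)) ?_ ?_ ?_ <;>
    simp <;> nlinarith

end Order

section Classification

variable {p q : ℕ}

/-- The trees that can be among the last four: every other tree precedes `treeB p q 0 2`. -/
def candidates (p q : ℕ) : List (SimpleGraph (Fin p ⊕ Fin q)) :=
  [treeB p q 0 0, treeB p q 0 1, treeB p q 2 0, treeB p q 0 2, treeD p q 0 1]

variable {V : Type u} [Fintype V] {T : SimpleGraph V}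

namespace IsHubTree

theorem sBefore_treeB_zero_two {s : Multiset ℕ} {m : ℕ} (hT : IsHubTree q s T) (hq : 4 ≤ q)
    (hsum : s.sum = m + 3) (hle : ∀ x ∈ s, x ≤ m) : SBefore T (treeB (m + 4) q 0 2) := by
  have treeB_hub : IsHubTree q {m + 1, 1, 1} (treeB (m + 4) q 0 2) :=
    isHubTree_treeB_zero_two (p := m + 4) (by omega) hq
  have sum_eq : s.sum = ({m + 1, 1, 1} : Multiset ℕ).sum := hsum
  have powerSum_treeB (k : ℕ) : powerSum {m + 1, 1, 1} k = (m + 1) ^ k + 2 := by simp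
  have le_two : powerSum s 2 ≤ (m + 1) ^ 2 + 2 := by
    have := powerSum_two_le_sq_add_sq hle hsum
    have bound := powerSum_succ_le hle 1
    rw [powerSum_one, hsum] at bound
    rcases le_total 3 m <;> nlinarith
  -- Equality occurs for the partition `{3, 3}` of `6`.
  rcases le_two.eq_or_lt with eq_two | lt_two
  · have lt_three : powerSum s 3 < (m + 1) ^ 3 + 2 :=
      calc powerSum s 3 ≤ m * ((m + 1) ^ 2 + 2) := eq_two ▸ powerSum_succ_le hle 2
        _ < (m + 1) ^ 3 + 2 := by nlinarith
    refine hT.sBefore_of_six_lt treeB_hub (by rw [sum_eq]) (by omega) ?_ ?_ <;>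
      rw [sum_eq, powerSum_treeB, eq_two]
    rw [powerSum_treeB]
    omega
  · refine hT.sBefore_of_four_lt treeB_hub (by rw [sum_eq]) (by omega) ?_
    rw [sum_eq, powerSum_treeB]
    omega

theorem iso_or_sBefore_of_white_hub {s : Multiset ℕ} (hp : 4 ≤ p) (hpq : p < q)
    (hT : IsHubTree q s T) (hs : 0 ∉ s) (hsum : s.sum + 1 = p) :
    (∃ G ∈ candidates p q, Nonempty (T ≃g G)) ∨ SBefore T (treeB p q 0 2) := by
  obtain ⟨m, rfl⟩ := Nat.exists_eq_add_of_le' hp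
  have hsum' : s.sum = m + 3 := by omega
  have iso (G) (hG : G ∈ candidates (m + 4) q) (h : IsHubTree q s G) :
      ∃ G ∈ candidates (m + 4) q, Nonempty (T ≃g G) := ⟨G, hG, hT.nonempty_iso h⟩
  rcases partition_cases hs hsum' with rfl | rfl | rfl | rfl | hle
  · exact .inl (iso (treeB (m + 4) q 0 0) (by simp [candidates])
      (isHubTree_treeB_zero_zero (p := m + 4) (by omega) (by omega)))
  · exact .inl (iso (treeB (m + 4) q 0 1) (by simp [candidates])
      (isHubTree_treeB_zero_one (p := m + 4) (by omega) (by omega)))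
  · exact .inl (iso (treeB (m + 4) q 2 0) (by simp [candidates])
      (isHubTree_treeB_two_zero hp (by omega)))
  · exact .inl (iso (treeB (m + 4) q 0 2) (by simp [candidates])
      (isHubTree_treeB_zero_two hp (by omega)))
  · exact .inr (hT.sBefore_treeB_zero_two (by omega) hsum' hle)

theorem iso_or_sBefore_of_black_hub {s : Multiset ℕ} (hp : 4 ≤ p) (hpq : p < q)
    (hT : IsHubTree p s T) (hs : 0 ∉ s) (hsum : s.sum + 1 = q) (hle : ∀ x ∈ s, x ≤ q - 2) :
    Nonempty (T ≃g treeD p q 0 1) ∨ SBefore T (treeB p q 0 2) := by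
  obtain ⟨m, rfl⟩ := Nat.exists_eq_add_of_le' (hp.trans hpq.le)
  have hsum' : s.sum = m + 1 + 2 := by omega
  have m_pos : 1 ≤ m := by omega
  have parts : s = {m + 2, 1} ∨ ∀ x ∈ s, x ≤ m + 1 := by
    rcases partition_cases hs hsum' with rfl | rfl | rfl | rfl | h
    · simp at hle
    · exact .inl rfl
    · exact .inr (by simpa)
    · exact .inr (by simp)
    · exact .inr fun x hx => (h x hx).trans m.le_succ
  rcases parts with rfl | hle'
  · exact .inl (hT.nonempty_iso (isHubTree_treeD_zero_one (q := m + 4) (by omega) (by omega)))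
  · have bound := powerSum_two_le_sq_add_sq hle' hsum'
    obtain ⟨a, rfl⟩ := Nat.exists_eq_add_of_le' hp
    obtain ⟨b, rfl⟩ : ∃ b, m = a + b + 1 := Nat.exists_eq_add_of_lt (by omega)
    refine .inr (hT.sBefore_of_four_lt
      (isHubTree_treeB_zero_two (q := a + b + 1 + 4) hp (by omega)) ?_ (by omega) ?_)
    · rw [hsum']
      simp
      omega
    · rw [hsum']
      simp
      nlinarith

end IsHubTree

theorem sBefore_of_not_isHub (hp : 4 ≤ p) (hpq : p < q) [Nontrivial V] (hT : T.IsTree)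
    {s t : Finset V} (hst : T.IsBipartiteWith s t) (hsp : s.card = p) (htq : t.card = q)
    (hs : ∀ u ∈ s, ¬ IsHub T t u) (ht : ∀ u ∈ t, ¬ IsHub T s u) :
    SBefore T (treeB p q 0 2) := by
  have white_bound := powerSum_two_le_sq_add_sq (k := 1) (excessDegrees_le_of_not_isHub hst hs)
    (by have := sum_excessDegrees_add_one hT hst; omega)
  have black_bound := powerSum_two_le_sq_add_sq (k := 1) (excessDegrees_le_of_not_isHub hst.symm ht)
    (by have := sum_excessDegrees_add_one hT hst.symm; omega)
  have card_eq : Fintype.card V = p + q := by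
    classical
    rw [← hsp, ← htq, ← Finset.card_union_of_disjoint (Finset.disjoint_coe.1 hst.disjoint),
      union_eq_univ_of_isBipartiteWith hT.connected hst, Finset.card_univ]
  have treeB_hub := isHubTree_treeB_zero_two hp (hp.trans hpq.le)
  refine .of_four_lt hT treeB_hub.isTree (by simp [card_eq]) (by omega) ?_
  rw [spectralMoment_four_of_isTree hT, excessDegrees_univ hT.connected hst, powerSum_add,
    treeB_hub.spectralMoment_four, card_eq, sub_lt_iff_lt_add]
  rw [hsp] at black_bound
  rw [htq] at white_bound
  obtain ⟨a, rfl⟩ := Nat.exists_eq_add_of_le' hp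
  obtain ⟨b, rfl⟩ := Nat.exists_eq_add_of_lt hpq
  norm_cast
  simp at white_bound black_bound ⊢
  nlinarith

theorem iso_or_sBefore_of_isBipartitionedTree (hp : 4 ≤ p) (hpq : p < q)
    (hT : IsBipartitionedTree (p + q) p q T) :
    (∃ G ∈ candidates p q, Nonempty (T ≃g G)) ∨ SBefore T (treeB p q 0 2) := by
  have : Nontrivial V := Fintype.one_lt_card_iff_nontrivial.1 (by rw [hT.card_eq]; omega)
  obtain ⟨isTree, card_eq, s, t, hst, -, hsp, htq⟩ := hT
  by_cases white_hub : ∃ u ∈ s, IsHub T t u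
  · obtain ⟨u, hu, hub⟩ := white_hub
    have key := htq ▸ isHubTree_of_isHub isTree hst hu hub
    exact key.iso_or_sBefore_of_white_hub hp hpq (by simp) (by have := key.card_eq; omega)
  push Not at white_hub
  by_cases black_hub : ∃ u ∈ t, IsHub T s u
  · obtain ⟨u, hu, hub⟩ := black_hub
    have key := hsp ▸ isHubTree_of_isHub isTree hst.symm hu hub
    refine (key.iso_or_sBefore_of_black_hub hp hpq (by simp) (by have := key.card_eq; omega)
      fun x hx => ?_).imp_left fun e => ⟨_, by simp [candidates], e⟩
    exact htq ▸ excessDegrees_le_of_not_isHub hst white_hub x (Multiset.mem_of_mem_filter hx)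
  push Not at black_hub
  exact .inr (sBefore_of_not_isHub hp hpq isTree hst hsp htq white_hub black_hub)

end Classification

section LastTrees

variable {p q : ℕ}

theorem isBipartitionedTree_of_mem_candidates (hp : 4 ≤ p) (hpq : p < q) :
    ∀ G ∈ candidates p q, IsBipartitionedTree (p + q) p q G := by
  have hq : 4 ≤ q := hp.trans hpq.le
  simp only [candidates, List.forall_mem_cons, List.not_mem_nil, false_imp_iff, implies_true,
    and_true]
  exact ⟨isBipartitionedTree_bipartiteGraphOf
      (isHubTree_treeB_zero_zero (by omega) (by omega)).isTree,
    isBipartitionedTree_bipartiteGraphOf (isHubTree_treeB_zero_one (by omega) (by omega)).isTree,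
    isBipartitionedTree_bipartiteGraphOf (isHubTree_treeB_two_zero hp (by omega)).isTree,
    isBipartitionedTree_bipartiteGraphOf (isHubTree_treeB_zero_two hp hq).isTree,
    isBipartitionedTree_bipartiteGraphOf (isHubTree_treeD_zero_one (by omega) (by omega)).isTree⟩

theorem areLastTrees_of_isChain (hp : 4 ≤ p) (hpq : p < q)
    {G₀ : SimpleGraph (Fin p ⊕ Fin q)} {L : List (SimpleGraph (Fin p ⊕ Fin q))}
    (mem_candidates : ∀ G ∈ G₀ :: L, G ∈ candidates p q)
    (chain : (G₀ :: L).IsChain SBefore)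
    (before_or_iso : ∀ C ∈ candidates p q, SBefore C G₀ ∨ ∃ G ∈ G₀ :: L, Nonempty (C ≃g G))
    (treeB_le : treeB p q 0 2 = G₀ ∨ SBefore (treeB p q 0 2) G₀) :
    AreLastTrees.{u} (p + q) p q (G₀ :: L) where
  mem G hG := isBipartitionedTree_of_mem_candidates hp hpq G (mem_candidates G hG)
  increasing := chain.pairwise
  last V _ T hT not_iso := by
    have before_head : SBefore T G₀ := by
      rcases iso_or_sBefore_of_isBipartitionedTree hp hpq hT with ⟨C, hC, ⟨e⟩⟩ | h
      · rcases before_or_iso C hC with h | ⟨G, hG, ⟨e'⟩⟩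
        · exact h.congr_left e
        · exact ((not_iso G hG).false (e.trans e')).elim
      · rcases treeB_le with rfl | h'
        · exact h
        · exact h.trans h'
    intro G hG
    rcases List.mem_cons.1 hG with rfl | hG
    · exact before_head
    · exact before_head.trans (List.rel_of_pairwise_cons chain.pairwise hG)

theorem areLastTrees_of_lt_two_mul (hpq : p < q) (h : q + 4 < 2 * p) :
    AreLastTrees.{u} (p + q) p q [treeB p q 2 0, treeD p q 0 1, treeB p q 0 1, treeB p q 0 0] := by
  have hp₄ : 4 ≤ p := by omega
  have hq : 4 ≤ q := by omega
  have B01_B00 := treeB_zero_one_sBefore_treeB_zero_zero hp₄ (by omega : 3 ≤ q)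
  have D01_B01 := treeD_zero_one_sBefore_treeB_zero_one (by omega) hpq
  have B20_D01 := treeB_two_zero_sBefore_treeD_zero_one hp₄ hpq h
  have B02_B20 := treeB_zero_two_sBefore_treeB_two_zero hp₄ hq
  exact areLastTrees_of_isChain hp₄ hpq (by simp [candidates])
    (by simp [B20_D01, D01_B01, B01_B00])
    (by simp [candidates, instNonemptyOfInhabited, B02_B20]) (.inr B02_B20)

theorem areLastTrees_of_eq_two_mul (hpq : p < q) (h : q + 4 = 2 * p) :
    AreLastTrees.{u} (p + q) p q [treeD p q 0 1, treeB p q 2 0, treeB p q 0 1, treeB p q 0 0] := by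
  have hp : 5 ≤ p := by omega
  have hp₄ : 4 ≤ p := by omega
  have hq : 3 ≤ q := by omega
  have B01_B00 := treeB_zero_one_sBefore_treeB_zero_zero hp₄ hq
  have B20_B01 := treeB_two_zero_sBefore_treeB_zero_one hp hq
  have D01_B20 := treeD_zero_one_sBefore_treeB_two_zero hp h
  have B02_D01 := treeB_zero_two_sBefore_treeD_zero_one hp₄ hpq h.le
  exact areLastTrees_of_isChain hp₄ hpq (by simp [candidates])
    (by simp [D01_B20, B20_B01, B01_B00])
    (by simp [candidates, instNonemptyOfInhabited, B02_D01]) (.inr B02_D01)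

theorem areLastTrees_of_two_mul_lt (hp : 5 ≤ p) (hpq : p < q) (h : 2 * p < q + 4) :
    AreLastTrees.{u} (p + q) p q [treeB p q 0 2, treeB p q 2 0, treeB p q 0 1, treeB p q 0 0] := by
  have hp₄ : 4 ≤ p := by omega
  have hq : 3 ≤ q := by omega
  have B01_B00 := treeB_zero_one_sBefore_treeB_zero_zero hp₄ hq
  have B20_B01 := treeB_two_zero_sBefore_treeB_zero_one hp hq
  have B02_B20 := treeB_zero_two_sBefore_treeB_two_zero hp₄ (by omega : 4 ≤ q)
  have D01_B02 := treeD_zero_one_sBefore_treeB_zero_two hp₄ hpq h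
  exact areLastTrees_of_isChain hp₄ hpq (by simp [candidates])
    (by simp [B02_B20, B20_B01, B01_B00])
    (by simp [candidates, instNonemptyOfInhabited, D01_B02]) (.inl rfl)

theorem areLastTrees_four (hq : 4 < q) :
    AreLastTrees.{u} (4 + q) 4 q [treeB 4 q 0 2, treeB 4 q 0 1, treeB 4 q 0 0] := by
  have B01_B00 := treeB_zero_one_sBefore_treeB_zero_zero le_rfl (by omega : 3 ≤ q)
  have B02_B01 := treeB_zero_two_sBefore_treeB_zero_one le_rfl hq.le
  have D01_B02 := treeD_zero_one_sBefore_treeB_zero_two le_rfl hq (by omega)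
  have B20_iso_B01 := treeB_two_zero_iso_treeB_zero_one (by omega : 3 ≤ q)
  exact areLastTrees_of_isChain le_rfl hq (by simp [candidates])
    (by simp [B02_B01, B01_B00])
    (by simp [candidates, instNonemptyOfInhabited, B20_iso_B01, D01_B02]) (.inl rfl)

end LastTrees

theorem theorem3p1 (n p q : ℕ) (hp : 4 ≤ p) (hpq : p < q) (hn : p + q = n) :
    ((p : ℝ) > ((q : ℝ) + 4) / 2 →
      AreLastTrees.{u} n p q [treeB p q 2 0, treeD p q 0 1, treeB p q 0 1, treeB p q 0 0]) ∧
    ((p : ℝ) = ((q : ℝ) + 4) / 2 →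
      AreLastTrees.{u} n p q [treeD p q 0 1, treeB p q 2 0, treeB p q 0 1, treeB p q 0 0]) ∧
    ((p : ℝ) < ((q : ℝ) + 4) / 2 → 5 ≤ p →
      AreLastTrees.{u} n p q [treeB p q 0 2, treeB p q 2 0, treeB p q 0 1, treeB p q 0 0]) ∧
    (p = 4 →
      Nonempty (treeB p q 2 0 ≃g treeB p q 0 1) ∧
      AreLastTrees.{u} n p q [treeB p q 0 2, treeB p q 0 1, treeB p q 0 0]) := by
  subst hn
  refine ⟨fun h => areLastTrees_of_lt_two_mul hpq ?_, fun h => areLastTrees_of_eq_two_mul hpq ?_,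
    fun h hp₅ => areLastTrees_of_two_mul_lt hp₅ hpq ?_, ?_⟩
  · rify
    linarith
  · rify
    linarith
  · rify
    linarith
  · rintro rfl
    exact ⟨treeB_two_zero_iso_treeB_zero_one (by omega), areLastTrees_four hpq⟩
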